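/- Let $N\ge 2$ and let $g:[0,+\infty)\to[0,+\infty)$ be continuous. For a $C^2$ function $u$ on an open subset of $\mathbb R^N$ put $$F(u)=\sum_{i=1}^{N-1}u_{x_ix_i}+g(u_{x_N}^2)\,u_{x_Nx_N}.$$ Assume that, for some $\bar t>0$, the following hold (derivatives at $\bar t$ being one-sided). (L) $0\le g\le 1$ on $[0,\bar t\,]$; $g$ is continuous on $[0,\bar t\,]$, positive and differentiable on $(0,\bar t\,]$; and $t\mapsto g(t)+t g'(t)$ is non-decreasing on $(0,\bar t\,]$. (G) There is a bounded function $f$ on $[0,+\infty)$, twice differentiable on $(0,+\infty)$, with $g(t)=f(t)+5tf'(t)+2t^2f''(t)$ for all $t>0$, such that $p\mapsto f(p^2)p^2$ is strictly convex on $\mathbb R$. Assume moreover that $g'(t)>0$ and $g(t)+t g'(t)\le 1$ for all $t\in(0,\bar t\,]$, and that $$\lim_{t\to0^+}\frac{g(t)^{3/2}}{t\,g'(t)}=0 .$$ Then there exist a connected, bounded, nonempty open set $\Omega\subset\mathbb R^N$ with $C^1$ boundary, a radial function $u\in C^2(\Omega)\cap C(\overline\Omega)$ (that is, $u(x)$ depends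 only on $|x|$) with $F(u)\le 0$ pointwise in $\Omega$, and a point $z\in\partial\Omega$ such that $$u(z)=0,\qquad u(z)<u(x)\ \text{ for every }x\in\Omega,\qquad \frac{\partial u}{\partial\nu}(z)=0,$$ where $\nu$ is the outer unit normal to $\Omega$ at $z$ and $\frac{\partial u}{\partial\nu}(z)$ is the one-sided derivative at $s=0$ of $s\mapsto u(z+s\nu)$, $s\le 0$. If, in addition, $g(t)/(t\,g'(t))$ is bounded on $(0,\bar t\,]$, then $\Omega$ also satisfies the interior ball condition at $z$: there is an open ball $B\subset\Omega$ with $z\in\partial B$. -/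

import Mathlib

/-- The local assumptions (L) for the operator `∑_{i<N} u_{x_i x_i} + g(u_{x_N}²) u_{x_N x_N}`,
on the interval `[0, T]`. The derivative at the right end point `T` is one-sided. -/
structure AssumptionL (g : ℝ → ℝ) (T : ℝ) : Prop where
  pos_T : 0 < T
  nonneg : ∀ t ∈ Set.Icc 0 T, 0 ≤ g t
  le_one : ∀ t ∈ Set.Icc 0 T, g t ≤ 1
  continuousOn : ContinuousOn g (Set.Icc 0 T)
  pos : ∀ t ∈ Set.Ioc 0 T, 0 < g t
  differentiableOn : DifferentiableOn ℝ g (Set.Ioc 0 T)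
  monotoneOn : MonotoneOn (fun t => g t + derivWithin g (Set.Ioc 0 T) t * t) (Set.Ioc 0 T)

/-- The growth assumption (G): the equation `g = f + 5 t f' + 2 t² f''` has a bounded solution `f`
on the half line, and `p ↦ f(p²) p²` is strictly convex. Here `f₁`, `f₂` are `f'`, `f''`. -/
def AssumptionG (g : ℝ → ℝ) : Prop :=
  ∃ f f₁ f₂ : ℝ → ℝ,
    (∀ t, 0 < t → HasDerivAt f (f₁ t) t ∧ HasDerivAt f₁ (f₂ t) t ∧
      g t = f t + 5 * t * f₁ t + 2 * t ^ 2 * f₂ t) ∧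
    (∃ C, ∀ t, 0 ≤ t → |f t| ≤ C) ∧
    StrictConvexOn ℝ Set.univ (fun p : ℝ => f (p ^ 2) * p ^ 2)

/-- The partial derivative `u_{x_i}`. -/
noncomputable def partialDeriv {N : ℕ} (i : Fin N) (u : EuclideanSpace ℝ (Fin N) → ℝ)
    (x : EuclideanSpace ℝ (Fin N)) : ℝ :=
  fderiv ℝ u x (EuclideanSpace.single i 1)

/-- The operator `F(u) = ∑_{i<N} u_{x_i x_i} + g(u_{x_N}²) u_{x_N x_N}` in dimension `N = n + 1`. -/
noncomputable def operatorF {n : ℕ} (g : ℝ → ℝ) (u : EuclideanSpace ℝ (Fin (n + 1)) → ℝ)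
    (x : EuclideanSpace ℝ (Fin (n + 1))) : ℝ :=
  (∑ i : Fin n, partialDeriv i.castSucc (partialDeriv i.castSucc u) x) +
    g (partialDeriv (Fin.last n) u x ^ 2) *
      partialDeriv (Fin.last n) (partialDeriv (Fin.last n) u) x

/-- `φ` is a `C¹` defining function of `Ω` near `z`: close to `z`, the set `Ω` is `{φ < 0}`,
and the gradient of `φ` does not vanish at `z`. -/
structure IsLocalDefiningFunction {N : ℕ} (Ω : Set (EuclideanSpace ℝ (Fin N)))
    (z : EuclideanSpace ℝ (Fin N)) (φ : EuclideanSpace ℝ (Fin N) → ℝ) : Prop where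
  contDiffAt : ContDiffAt ℝ 1 φ z
  gradient_ne_zero : gradient φ z ≠ 0
  mem_iff : ∀ᶠ x in nhds z, x ∈ Ω ↔ φ x < 0

/-- Regular region: a connected (in particular nonempty), open and bounded set whose boundary is of
class `C¹`, that is, has a continuously varying tangent plane with `Ω` on one side of it. -/
structure IsRegularRegion {N : ℕ} (Ω : Set (EuclideanSpace ℝ (Fin N))) : Prop where
  isOpen : IsOpen Ω
  isConnected : IsConnected Ω
  isBounded : Bornology.IsBounded Ω
  boundary : ∀ z ∈ frontier Ω, ∃ φ, IsLocalDefiningFunction Ω z φ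

/-- `ν` is the outer unit normal to `Ω` at the boundary point `z`. -/
def IsOuterUnitNormal {N : ℕ} (Ω : Set (EuclideanSpace ℝ (Fin N)))
    (z ν : EuclideanSpace ℝ (Fin N)) : Prop :=
  ‖ν‖ = 1 ∧ ∃ φ, IsLocalDefiningFunction Ω z φ ∧ gradient φ z = ‖gradient φ z‖ • ν

/-- Interior ball condition at `z`: some open ball `B ⊆ Ω` has `z ∈ ∂B`. -/
def InteriorBallCondition {N : ℕ} (Ω : Set (EuclideanSpace ℝ (Fin N)))
    (z : EuclideanSpace ℝ (Fin N)) : Prop :=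
  ∃ (c : EuclideanSpace ℝ (Fin N)) (r : ℝ), 0 < r ∧ Metric.ball c r ⊆ Ω ∧
    z ∈ frontier (Metric.ball c r)

open Set Filter Topology MeasureTheory

/-! The boundary point lemma fails because the equation `v' = v / (4 g(v²))` has a solution leaving
`0` at finite depth. Separating variables gives `H(v²) = h` with `H'(t) = 2 g(t) / t`. The limit
hypothesis bounds `g(t) / t` by the derivative of `2 √g` near `0`, so `H` can be normalised by `H(0)
= 0` (`exists_primitive_div_id`). With `W' = v` and `W(0) = 0`, the function `u = W(1 - |x|)` is
positive inside the unit sphere and vanishes on it with zero normal derivative.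

Let `θ` be the angle between `x` and the last axis. The bad term of `F(u)` is `v' (sin²θ + γ cos²θ)`
with `γ ≤ g(v²)`; wherever `sin²θ ≤ g(v²)` it is at most `v / 2`, and the tangential curvature terms
absorb it (`operatorF_comp_norm_nonpos`). Near the pole this holds as soon as the depth `h = 1 -
|x|` is at least `K(ρ) = H(g⁻¹(2ρ²))`, where `ρ` is the distance to the axis (`exists_profile`).

Comparing `H` with `ε √g` gives `K(ρ) = o(ρ)`. Hence a ball touching the sphere at the pole, shaved
by a `C¹` majorant of `K`, lies in `h ≥ K(ρ)` and keeps a `C¹` boundary (`exists_C1_majorant`,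
`bounds_of_mem_thinnedBall`). If `g / (t g')` is bounded, then `H ≤ 2 M g`, so `K(ρ) = O(ρ²)` and a
small ball needs no shaving (`exists_thinning`). -/

/-! ### One-variable tools: inversion, singular primitives, comparison. -/

/-- A continuous strictly increasing function on `[0, T]` extends to an order automorphism of `ℝ`. -/
theorem exists_orderIso_eqOn_Icc {f : ℝ → ℝ} {T : ℝ} (hT : 0 ≤ T)
    (hc : ContinuousOn f (Icc 0 T)) (hm : StrictMonoOn f (Icc 0 T)) :
    ∃ e : ℝ ≃o ℝ, ∀ t ∈ Icc 0 T, e t = f t := by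
  set p : ℝ → ℝ := fun t => max 0 (min T t) with hp
  have hpm : Monotone p := fun a b hab => max_le_max le_rfl (min_le_min le_rfl hab)
  have hpI : ∀ t, p t ∈ Icc 0 T := fun t => ⟨le_max_left _ _, max_le hT (min_le_left _ _)⟩
  have hpe : ∀ t ∈ Icc 0 T, p t = t := fun t ht => by
    simp only [hp]; rw [min_eq_right ht.2, max_eq_right ht.1]
  have hpl : ∀ {a b : ℝ}, a ≤ b → p b - p a ≤ b - a := by
    intro a b hab
    simp only [hp]
    grind
  -- Clamping freezes `f` outside the interval; the term `t - p t` adds slope one there and vanishes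
  -- inside.
  set F : ℝ → ℝ := fun t => f (p t) + (t - p t) with hF
  have hpc : Continuous p := by fun_prop
  have hFc : Continuous F :=
    (hc.comp_continuous hpc hpI).add (continuous_id.sub hpc)
  have hFm : StrictMono F := by
    intro a b hab
    simp only [hF]
    have h1 := hpl hab.le
    rcases (hpm hab.le).eq_or_lt with h | h
    · rw [h]; linarith
    · have := hm (hpI a) (hpI b) h
      linarith
  have hFtop : Tendsto F atTop atTop := by
    refine tendsto_atTop_mono (f := fun t => t + (f 0 - T)) (fun t => ?_)
      (tendsto_atTop_add_const_right _ _ tendsto_id)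
    have h1 := hm.monotoneOn (left_mem_Icc.2 hT) (hpI t) (hpI t).1
    have h2 := (hpI t).2
    simp only [hF]; linarith
  have hFbot : Tendsto F atBot atBot := by
    refine tendsto_atBot_mono (fun t => ?_)
      (tendsto_atBot_add_const_right _ (f T) tendsto_id)
    have h1 := hm.monotoneOn (hpI t) (right_mem_Icc.2 hT) (hpI t).2
    have h2 := (hpI t).1
    simp only [hF, id]; linarith
  refine ⟨hFm.orderIsoOfSurjective F (hFc.surjective hFtop hFbot), fun t ht => ?_⟩
  simp [hF, hpe t ht]

/-- The primitive of `2 g(s) / s` that vanishes at `0` exists as soon as `g(s) / s` is controlled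
by the derivative of `2 √g`. -/
theorem exists_primitive_div_id {g g' : ℝ → ℝ} {T : ℝ} (hT : 0 < T)
    (hc : ContinuousOn g (Icc 0 T)) (hpos : ∀ t ∈ Ioc 0 T, 0 < g t)
    (hd : ∀ t ∈ Ioo 0 T, HasDerivAt g (g' t) t)
    (hle : ∀ t ∈ Ioo 0 T, g t / t ≤ g' t / √(g t)) :
    ∃ H : ℝ → ℝ, H 0 = 0 ∧ ContinuousOn H (Icc 0 T) ∧
      ∀ t ∈ Ioo 0 T, HasDerivAt H (2 * (g t / t)) t := by
  have hcq : ContinuousOn (fun t => g t / t) (Ioo 0 T) :=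
    (hc.mono Ioo_subset_Icc_self).div continuousOn_id fun t ht => ht.1.ne'
  have hds : ∀ t ∈ Ioo 0 T, HasDerivAt (fun t => 2 * √(g t)) (g' t / √(g t)) t := by
    intro t ht
    have h0 := hpos t ⟨ht.1, ht.2.le⟩
    refine (((hd t ht).sqrt h0.ne').const_mul 2).congr_deriv ?_
    field_simp
  have hq0 : ∀ t ∈ Ioo 0 T, 0 ≤ g t / t := fun t ht =>
    div_nonneg (hpos t ⟨ht.1, ht.2.le⟩).le ht.1.le
  -- `2 √g` is continuous up to `0` with nonnegative derivative, so this derivative is integrable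
  -- even if it blows up at `0`.
  have hint : IntegrableOn (fun t => g' t / √(g t)) (Ioc 0 T) :=
    intervalIntegral.integrableOn_deriv_of_nonneg
      ((continuousOn_const).mul hc.sqrt) hds (fun t ht => (hq0 t ht).trans (hle t ht))
  have hint2 : IntegrableOn (fun t => g t / t) (Ioo 0 T) := by
    refine Integrable.mono' (hint.mono_set Ioo_subset_Ioc_self)
      (hcq.aestronglyMeasurable measurableSet_Ioo) ?_
    filter_upwards [ae_restrict_mem measurableSet_Ioo] with t ht
    rw [Real.norm_of_nonneg (hq0 t ht)]
    exact hle t ht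
  have hint3 : IntegrableOn (fun t => g t / t) (Icc 0 T) :=
    (integrableOn_Icc_iff_integrableOn_Ioo (by simp) (by simp)).2 hint2
  refine ⟨fun t => 2 * ∫ s in (0 : ℝ)..t, g s / s, by simp, ?_, fun t ht => ?_⟩
  · refine continuousOn_const.mul ?_
    have := intervalIntegral.continuousOn_primitive_interval (μ := volume) (a := 0) (b := T)
      (f := fun t => g t / t) (by rwa [uIcc_of_le hT.le])
    rwa [uIcc_of_le hT.le] at this
  · refine (intervalIntegral.integral_hasDerivAt_right ?_ ?_ ?_).const_mul 2
    · rw [intervalIntegrable_iff_integrableOn_Icc_of_le ht.1.le]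
      exact hint3.mono_set (Icc_subset_Icc le_rfl ht.2.le)
    · exact hcq.stronglyMeasurableAtFilter isOpen_Ioo t ht
    · exact hcq.continuousAt (isOpen_Ioo.mem_nhds ht)

/-- Comparison of two functions vanishing at the left end point, through their derivatives. -/
theorem le_of_hasDerivAt_le {A B A' B' : ℝ → ℝ} {t : ℝ} (ht : 0 ≤ t)
    (hA : ContinuousOn A (Icc 0 t)) (hB : ContinuousOn B (Icc 0 t))
    (hA' : ∀ s ∈ Ioo 0 t, HasDerivAt A (A' s) s) (hB' : ∀ s ∈ Ioo 0 t, HasDerivAt B (B' s) s)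
    (hle : ∀ s ∈ Ioo 0 t, A' s ≤ B' s) (h0 : A 0 = 0) (h0' : B 0 = 0) : A t ≤ B t := by
  have hm : MonotoneOn (fun s => B s - A s) (Icc 0 t) := by
    refine monotoneOn_of_deriv_nonneg (convex_Icc 0 t) (hB.sub hA) ?_ ?_
    · rw [interior_Icc]
      exact fun s hs => ((hB' s hs).sub (hA' s hs)).differentiableAt.differentiableWithinAt
    · rw [interior_Icc]
      intro s hs
      have : deriv (fun s => B s - A s) s = _ := ((hB' s hs).sub (hA' s hs)).deriv
      rw [this]
      linarith [hle s hs]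
  have := hm (left_mem_Icc.2 ht) (right_mem_Icc.2 ht) ht
  simp only at this
  linarith

/-! ### `C¹` radial functions and `C¹` majorants. -/

theorem hasFDerivAt_norm_of_ne_zero {E : Type*} [NormedAddCommGroup E] [InnerProductSpace ℝ E]
    {x : E} (hx : x ≠ 0) : HasFDerivAt (fun x : E => ‖x‖) (‖x‖⁻¹ • innerSL ℝ x) x := by
  have hn : 0 < ‖x‖ := norm_pos_iff.2 hx
  have h2 := (hasStrictFDerivAt_norm_sq x).hasFDerivAt.sqrt (by positivity)
  have h3 : (fun y : E => √(‖y‖ ^ 2)) = fun y => ‖y‖ := by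
    ext y; exact Real.sqrt_sq (norm_nonneg y)
  rw [h3, Real.sqrt_sq hn.le] at h2
  convert h2 using 1
  ext y
  simp
  field_simp

/-- A radial function `x ↦ k ‖x‖` is `C¹` when `k` is `C¹` on `(0, ∞)` with `k' → 0` at `0`. -/
theorem hasFDerivAt_comp_norm {E : Type*} [NormedAddCommGroup E] [InnerProductSpace ℝ E]
    {k k' : ℝ → ℝ} (h0 : k 0 = 0) (hk : ∀ r, 0 < r → HasDerivAt k (k' r) r)
    (hlim0 : Tendsto (fun r => k r / r) (𝓝[>] 0) (𝓝 0)) (x : E) :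
    HasFDerivAt (fun x : E => k ‖x‖) ((k' ‖x‖ / ‖x‖) • innerSL ℝ x) x := by
  rcases eq_or_ne x 0 with rfl | hx
  · rw [map_zero, smul_zero, hasFDerivAt_iff_isLittleO_nhds_zero, Asymptotics.isLittleO_iff]
    intro c hc
    have h1 : ∀ᶠ r in 𝓝[>] (0 : ℝ), |k r| ≤ c * r := by
      filter_upwards [hlim0 (Metric.closedBall_mem_nhds 0 hc), self_mem_nhdsWithin] with r hr hr0
      have hr0' : (0 : ℝ) < r := hr0
      simp only [mem_preimage, Metric.mem_closedBall, dist_zero_right, Real.norm_eq_abs, abs_div,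
        abs_of_pos hr0'] at hr
      rwa [div_le_iff₀ hr0'] at hr
    rw [eventually_nhdsWithin_iff] at h1
    have h2 := (continuous_norm (E := E)).tendsto' 0 0 norm_zero |>.eventually h1
    filter_upwards [h2] with y hy
    rcases eq_or_ne y 0 with rfl | hy0
    · simp
    · simpa [h0] using hy (norm_pos_iff.2 hy0)
  · have hn : 0 < ‖x‖ := norm_pos_iff.2 hx
    have := (hk _ hn).comp_hasFDerivAt x (hasFDerivAt_norm_of_ne_zero hx)
    rwa [smul_smul, ← div_eq_mul_inv] at this

theorem continuous_smul_innerSL {E : Type*} [NormedAddCommGroup E] [InnerProductSpace ℝ E]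
    {k' : ℝ → ℝ} (hk : ContinuousOn k' (Ioi 0)) (hlim : Tendsto k' (𝓝[>] 0) (𝓝 0)) :
    Continuous (fun x : E => (k' ‖x‖ / ‖x‖) • innerSL ℝ x) := by
  rw [continuous_iff_continuousAt]
  intro x
  rcases eq_or_ne x 0 with rfl | hx
  · rw [ContinuousAt, map_zero, smul_zero, tendsto_zero_iff_norm_tendsto_zero, Metric.tendsto_nhds]
    intro ε hε
    have h1 := hlim (Metric.ball_mem_nhds 0 hε)
    rw [mem_map, mem_nhdsWithin_iff_eventually] at h1
    have h2 := (continuous_norm (E := E)).tendsto' 0 0 norm_zero |>.eventually h1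
    filter_upwards [h2] with y hy
    rcases eq_or_ne y 0 with rfl | hy0
    · simpa using hε
    · have hn : 0 < ‖y‖ := norm_pos_iff.2 hy0
      have := hy hn
      simp only [mem_preimage, Metric.mem_ball, dist_zero_right, Real.norm_eq_abs] at this
      rw [norm_smul, innerSL_apply_norm, norm_div, norm_norm, div_mul_cancel₀ _ hn.ne']
      simpa using this
  · have hn : 0 < ‖x‖ := norm_pos_iff.2 hx
    have h1 : ContinuousAt (fun y : E => k' ‖y‖) x :=
      (hk.continuousAt (Ioi_mem_nhds hn)).comp continuous_norm.continuousAt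
    exact (h1.div continuous_norm.continuousAt hn.ne').smul (innerSL ℝ).continuous.continuousAt

/-- A continuous function that increases on `[0, ∞)` and is `o(r)` at `0` has a `C¹` majorant that
increases and is `o(r)` at `0`, namely its mean on `[r, 2 r]`. -/
theorem exists_C1_majorant {K : ℝ → ℝ} (hc : Continuous K) (hm : MonotoneOn K (Ici 0))
    (h0 : K 0 = 0) (hlim : Tendsto (fun r => K r / r) (𝓝[>] 0) (𝓝 0)) :
    ∃ k k' : ℝ → ℝ, k 0 = 0 ∧ (∀ r, 0 < r → HasDerivAt k (k' r) r) ∧ (∀ r, 0 < r → 0 ≤ k' r) ∧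
      ContinuousOn k' (Ioi 0) ∧ Tendsto k' (𝓝[>] 0) (𝓝 0) ∧
      Tendsto (fun r => k r / r) (𝓝[>] 0) (𝓝 0) ∧ ∀ r, 0 ≤ r → K r ≤ k r := by
  set J : ℝ → ℝ := fun x => ∫ s in (0 : ℝ)..x, K s with hJ
  have hJd : ∀ x, HasDerivAt J (K x) x := fun x => hc.integral_hasStrictDerivAt 0 x |>.hasDerivAt
  have hJc : Continuous J := continuous_iff_continuousAt.2 fun x => (hJd x).continuousAt
  have hJsub : ∀ r, J (2 * r) - J r = ∫ s in r..(2 * r), K s := fun r =>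
    intervalIntegral.integral_interval_sub_left (hc.intervalIntegrable _ _)
      (hc.intervalIntegrable _ _)
  have hlow : ∀ r, 0 < r → r * K r ≤ J (2 * r) - J r := by
    intro r hr
    rw [hJsub]
    have := intervalIntegral.integral_mono_on (a := r) (b := 2 * r) (μ := volume)
      (f := fun _ => K r) (g := K) (by linarith) (by simp) (hc.intervalIntegrable _ _)
      (fun s hs => hm hr.le (hr.le.trans hs.1) hs.1)
    rw [intervalIntegral.integral_const, smul_eq_mul] at this
    convert this using 1; ring
  have hupp : ∀ r, 0 < r → J (2 * r) - J r ≤ r * K (2 * r) := by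
    intro r hr
    rw [hJsub]
    have := intervalIntegral.integral_mono_on (a := r) (b := 2 * r) (μ := volume)
      (f := K) (g := fun _ => K (2 * r)) (by linarith) (hc.intervalIntegrable _ _) (by simp)
      (fun s hs => hm (hr.le.trans hs.1) (by simp [hr.le]) hs.2)
    rw [intervalIntegral.integral_const, smul_eq_mul] at this
    convert this using 1; ring
  have hK0 : ∀ r, 0 ≤ r → 0 ≤ K r := fun r hr => h0 ▸ hm (by simp) hr hr
  have hlim2 : Tendsto (fun r => 2 * (K (2 * r) / (2 * r))) (𝓝[>] 0) (𝓝 0) := by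
    have h1 : Tendsto (fun r : ℝ => 2 * r) (𝓝[>] 0) (𝓝[>] 0) := by
      refine tendsto_nhdsWithin_iff.2 ⟨?_, ?_⟩
      · exact ((continuous_const_mul (2 : ℝ)).tendsto' 0 0 (by simp)).mono_left nhdsWithin_le_nhds
      · filter_upwards [self_mem_nhdsWithin] with r hr
        have : (0 : ℝ) < r := hr
        simpa
    simpa using (hlim.comp h1).const_mul 2
  -- By `hupp` the numerator is at least `r (K(2r) - K(r))`.
  have hk'0 : ∀ r, 0 < r →
      0 ≤ ((K (2 * r) * 2 - K r) * r - (J (2 * r) - J r) * 1) / r ^ 2 := by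
    intro r hr
    have h1 := hupp r hr
    have h2 := hm (a := r) (b := 2 * r) hr.le (by simp [hr.le]) (by linarith)
    have h3 := mul_nonneg hr.le (sub_nonneg.2 h2)
    exact div_nonneg (by nlinarith) (by positivity)
  refine ⟨fun r => (J (2 * r) - J r) / r,
    fun r => ((K (2 * r) * 2 - K r) * r - (J (2 * r) - J r) * 1) / r ^ 2, by simp, ?_, hk'0, ?_,
    ?_, ?_, ?_⟩
  · intro r hr
    have h1 : HasDerivAt (fun r => J (2 * r)) (K (2 * r) * 2) r :=
      (hJd (2 * r)).comp r (by simpa using (hasDerivAt_id r).const_mul 2)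
    exact (h1.sub (hJd r)).div (hasDerivAt_id r) hr.ne'
  · refine ContinuousOn.div (by fun_prop) (by fun_prop) fun r hr => ?_
    have : (0 : ℝ) < r := hr
    positivity
  -- Dropping the nonpositive terms leaves `k' r ≤ 4 · K(2r) / (2r)`.
  · refine tendsto_of_tendsto_of_tendsto_of_le_of_le' tendsto_const_nhds
      (by simpa using hlim2.const_mul 2) ?_ ?_
    · filter_upwards [self_mem_nhdsWithin] with r hr using hk'0 r hr
    · filter_upwards [self_mem_nhdsWithin] with r hr
      have hr' : (0 : ℝ) < r := hr
      have h1 := hlow r hr'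
      have h2 := mul_nonneg hr'.le (hK0 r hr'.le)
      rw [div_le_iff₀ (by positivity)]
      field_simp
      nlinarith
  · refine tendsto_of_tendsto_of_tendsto_of_le_of_le' tendsto_const_nhds hlim2 ?_ ?_
    · filter_upwards [self_mem_nhdsWithin] with r hr
      have hr' : (0 : ℝ) < r := hr
      have h1 := hlow r hr'
      have h2 := mul_nonneg hr'.le (hK0 r hr'.le)
      exact div_nonneg (div_nonneg (by linarith) hr'.le) hr'.le
    · filter_upwards [self_mem_nhdsWithin] with r hr
      have hr' : (0 : ℝ) < r := hr
      have h1 := hupp r hr'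
      rw [div_le_iff₀ hr', div_le_iff₀ hr']
      field_simp
      linarith
  · intro r hr
    rcases hr.eq_or_lt with rfl | hr
    · simp [h0]
    · rw [le_div_iff₀ hr]
      linarith [hlow r hr]

/-! ### The slope `v` and the depth function `K`. -/

theorem Real.rpow_three_halves {x : ℝ} (hx : 0 < x) : x ^ (3 / 2 : ℝ) = x * √x := by
  rw [show (3 / 2 : ℝ) = 1 + 1 / 2 by norm_num, Real.rpow_add hx, Real.rpow_one,
    Real.sqrt_eq_rpow]

/-- Puts the limit hypothesis in integrable form: `b / √a` is the derivative of `2 √g` when `a = g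
t` and `b = g' t`. The value `c = 1` serves to construct `H`, small `c` to show `K(r) = o(r)`. -/
theorem div_le_mul_div_sqrt {a t b c : ℝ} (ha : 0 < a) (ht : 0 < t) (hb : 0 < b)
    (h : a ^ (3 / 2 : ℝ) / (t * b) ≤ c) : a / t ≤ c * (b / √a) := by
  rw [Real.rpow_three_halves ha, div_le_iff₀ (by positivity)] at h
  have hs := Real.sqrt_pos.2 ha
  rw [div_le_iff₀ ht, ← mul_div_assoc, div_mul_eq_mul_div, le_div_iff₀ hs]
  linarith

theorem strictMonoOn_Icc_of_hasDerivAt_pos {f f' : ℝ → ℝ} {a b : ℝ} (hc : ContinuousOn f (Icc a b))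
    (hd : ∀ t ∈ Ioo a b, HasDerivAt f (f' t) t) (hf' : ∀ t ∈ Ioo a b, 0 < f' t) :
    StrictMonoOn f (Icc a b) := by
  refine strictMonoOn_of_deriv_pos (convex_Icc a b) hc fun t ht => ?_
  rw [interior_Icc] at ht
  rw [(hd t ht).deriv]
  exact hf' t ht

/-- The radial slope `v`, a solution of `v' = v / (4 g(v²))` leaving `0`, and the function `K` such
that `K r ≤ h` ensures `2 r² ≤ g(v(h)²)`. -/
theorem exists_profile {g g' : ℝ → ℝ} {T : ℝ} (hT : 0 < T)
    (hc : ContinuousOn g (Icc 0 T)) (h0 : g 0 = 0) (hpos : ∀ t ∈ Ioc 0 T, 0 < g t)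
    (hd : ∀ t ∈ Ioo 0 T, HasDerivAt g (g' t) t) (hg' : ∀ t ∈ Ioo 0 T, 0 < g' t)
    (hle : ∀ t ∈ Ioo 0 T, g t ^ (3 / 2 : ℝ) / (t * g' t) ≤ 1)
    (hlim : Tendsto (fun t => g t ^ (3 / 2 : ℝ) / (t * g' t)) (𝓝[>] 0) (𝓝 0)) :
    ∃ (v K : ℝ → ℝ) (δ ρ : ℝ), 0 < δ ∧ 0 < ρ ∧ Continuous v ∧ v 0 = 0 ∧ (∀ h, 0 < h → 0 < v h) ∧
      (∀ h ∈ Ioo 0 δ, v h ^ 2 ∈ Ioo 0 T ∧ HasDerivAt v (v h / (4 * g (v h ^ 2))) h) ∧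
      Continuous K ∧ MonotoneOn K (Ici 0) ∧ K 0 = 0 ∧
      Tendsto (fun r => K r / r) (𝓝[>] 0) (𝓝 0) ∧
      (∀ r, ∀ h ∈ Ioo 0 δ, K r ≤ h → 2 * r ^ 2 ≤ g (v h ^ 2)) ∧
      ∀ M, (∀ t ∈ Ioo 0 T, g t / (t * g' t) ≤ M) → ∀ r ∈ Ico 0 ρ, K r ≤ 4 * M * r ^ 2 := by
  obtain ⟨H, H0, Hc, Hd⟩ := exists_primitive_div_id hT hc hpos hd fun t ht => by
    simpa using div_le_mul_div_sqrt (hpos t ⟨ht.1, ht.2.le⟩) ht.1 (hg' t ht) (hle t ht)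
  have hgm := strictMonoOn_Icc_of_hasDerivAt_pos hc hd hg'
  have hHm : StrictMonoOn H (Icc 0 T) := by
    refine strictMonoOn_Icc_of_hasDerivAt_pos Hc Hd fun t ht => ?_
    have := hpos t ⟨ht.1, ht.2.le⟩
    have := ht.1
    positivity
  -- Global extensions make both inverses continuous and monotone on all of `ℝ`; only values in `[0,
  -- T]` matter later.
  obtain ⟨eg, heg⟩ := exists_orderIso_eqOn_Icc hT.le hc hgm
  obtain ⟨eH, heH⟩ := exists_orderIso_eqOn_Icc hT.le Hc hHm
  have mem0 : (0 : ℝ) ∈ Icc 0 T := left_mem_Icc.2 hT.le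
  have memT : T ∈ Icc 0 T := right_mem_Icc.2 hT.le
  have eg0 : eg.symm 0 = 0 := by rw [OrderIso.symm_apply_eq, heg 0 mem0, h0]
  have eH0 : eH.symm 0 = 0 := by rw [OrderIso.symm_apply_eq, heH 0 mem0, H0]
  have hτ : ∀ {h}, 0 < h → 0 < eH.symm h := fun hh => by
    rw [← eH0]; exact eH.symm.strictMono hh
  have hσ : ∀ {r}, 0 ≤ r → 0 ≤ eg.symm r := fun hr => by
    rw [← eg0]; exact eg.symm.monotone hr
  have hHT : 0 < H T := H0 ▸ hHm mem0 memT hT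
  have hgT : 0 < g T := hpos T ⟨hT, le_rfl⟩
  have hv2 : ∀ {h}, 0 < h → √(eH.symm h) ^ 2 = eH.symm h := fun hh =>
    Real.sq_sqrt (hτ hh).le
  have hτT : ∀ h ∈ Ioo 0 (H T), eH.symm h ∈ Ioo 0 T := fun h hh => ⟨hτ hh.1, by
    rw [OrderIso.symm_apply_lt, heH T memT]; exact hh.2⟩
  have hσT : ∀ r ∈ Ico 0 (√(g T / 2)), eg.symm (2 * r ^ 2) ∈ Ico 0 T := fun r hr =>
    ⟨hσ (by positivity), by
      rw [OrderIso.symm_apply_lt, heg T memT]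
      have := (Real.lt_sqrt hr.1).1 hr.2
      linarith⟩
  have hgσ : ∀ r ∈ Ico 0 (√(g T / 2)), g (eg.symm (2 * r ^ 2)) = 2 * r ^ 2 := fun r hr => by
    rw [← heg _ (Ico_subset_Icc_self (hσT r hr)), OrderIso.apply_symm_apply]
  have hKH : ∀ r ∈ Ico 0 (√(g T / 2)), eH (eg.symm (2 * r ^ 2)) = H (eg.symm (2 * r ^ 2)) :=
    fun r hr => heH _ (Ico_subset_Icc_self (hσT r hr))
  have hKc : Continuous fun r : ℝ => eH (eg.symm (2 * r ^ 2)) :=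
    eH.continuous.comp (eg.symm.continuous.comp (by fun_prop))
  have hKm : MonotoneOn (fun r : ℝ => eH (eg.symm (2 * r ^ 2))) (Ici 0) := by
    intro a ha b _ hab
    have ha' : (0 : ℝ) ≤ a := ha
    exact eH.monotone (eg.symm.monotone (by gcongr))
  have hK0 : eH (eg.symm (2 * (0 : ℝ) ^ 2)) = 0 := by
    simp [eg0, heH 0 mem0, H0]
  have hρ : 0 < √(g T / 2) := by positivity
  -- With `v² = H⁻¹` and `K(r) = H(g⁻¹(2r²))`, monotonicity turns `K r ≤ h` into `2r² ≤ g(v(h)²)`.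
  refine ⟨fun h => √(eH.symm h), fun r => eH (eg.symm (2 * r ^ 2)), H T, √(g T / 2), hHT, hρ,
    eH.symm.continuous.sqrt, by simp [eH0], fun h hh => Real.sqrt_pos.2 (hτ hh), ?_, hKc, hKm, hK0,
    ?_, ?_, ?_⟩
  · intro h hh
    have ht := hτT h hh
    simp only [hv2 hh.1]
    refine ⟨ht, ?_⟩
    have hgt := hpos _ ⟨ht.1, ht.2.le⟩
    have hde : HasDerivAt eH (2 * (g (eH.symm h) / eH.symm h)) (eH.symm h) := by
      refine (Hd _ ht).congr_of_eventuallyEq ?_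
      filter_upwards [Icc_mem_nhds ht.1 ht.2] with s hs using heH s hs
    have hpos' : 0 < 2 * (g (eH.symm h) / eH.symm h) := by have := ht.1; positivity
    have h1 := HasDerivAt.of_local_left_inverse (f := eH) (g := eH.symm) (a := h)
      eH.symm.continuous.continuousAt hde hpos'.ne' (Eventually.of_forall eH.apply_symm_apply)
    refine (h1.sqrt ht.1.ne').congr_deriv ?_
    have hs := Real.sqrt_pos.2 ht.1
    have hss := Real.sq_sqrt ht.1.le
    field_simp
    rw [hss]; ring
  · rw [Metric.tendsto_nhds]
    intro ε hε
    -- The comparison below yields `K r ≤ 4 (ε/9) √(2r²) ≤ (8/9) ε r`, hence the `9`.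
    have h1 := hlim (Metric.ball_mem_nhds 0 (show 0 < ε / 9 by positivity))
    rw [mem_map, mem_nhdsGT_iff_exists_Ioo_subset] at h1
    obtain ⟨t₁, ht₁, hsub⟩ := h1
    have h2 : ∀ᶠ r in 𝓝[>] (0 : ℝ), eg.symm (2 * r ^ 2) < t₁ := by
      have hcont : Continuous fun r : ℝ => eg.symm (2 * r ^ 2) :=
        eg.symm.continuous.comp (by fun_prop)
      exact ((hcont.tendsto' 0 0 (by simp [eg0])).mono_left nhdsWithin_le_nhds).eventually
        (gt_mem_nhds ht₁)
    filter_upwards [h2, Ioo_mem_nhdsGT hρ] with r hr hr2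
    have hr0 : 0 < r := hr2.1
    have hr3 : r ∈ Ico 0 (√(g T / 2)) := ⟨hr2.1.le, hr2.2⟩
    have hKnn : 0 ≤ eH (eg.symm (2 * r ^ 2)) :=
      hK0.symm.le.trans (hKm (a := 0) (b := r) self_mem_Ici hr0.le hr0.le)
    have htT := hσT r hr3
    rw [dist_zero_right, Real.norm_of_nonneg (by positivity), div_lt_iff₀ hr0, hKH r hr3]
    have hsubI : Icc 0 (eg.symm (2 * r ^ 2)) ⊆ Icc 0 T := Icc_subset_Icc le_rfl htT.2.le
    have key := le_of_hasDerivAt_le (A := H) (B := fun t => 4 * (ε / 9) * √(g t))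
      (A' := fun s => 2 * (g s / s)) (B' := fun s => 4 * (ε / 9) * (g' s / (2 * √(g s)))) htT.1
      (Hc.mono hsubI) (continuousOn_const.mul (hc.mono hsubI).sqrt)
      (fun s hs => Hd s ⟨hs.1, hs.2.trans htT.2⟩)
      (fun s hs => ((hd s ⟨hs.1, hs.2.trans htT.2⟩).sqrt
        (hpos s ⟨hs.1, (hs.2.trans htT.2).le⟩).ne').const_mul _)
      (fun s hs => by
        have hsT : s ∈ Ioo 0 T := ⟨hs.1, hs.2.trans htT.2⟩
        have := hsub (show s ∈ Ioo 0 t₁ from ⟨hs.1, hs.2.trans hr⟩)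
        simp only [mem_preimage, Metric.mem_ball, dist_zero_right, Real.norm_eq_abs] at this
        have := div_le_mul_div_sqrt (hpos s ⟨hs.1, hsT.2.le⟩) hs.1 (hg' s hsT)
          ((le_abs_self _).trans this.le)
        have hs' := Real.sqrt_pos.2 (hpos s ⟨hs.1, hsT.2.le⟩)
        calc 2 * (g s / s) ≤ 2 * (ε / 9 * (g' s / √(g s))) := by gcongr
          _ = 4 * (ε / 9) * (g' s / (2 * √(g s))) := by field_simp; ring)
      H0 (by simp [h0])
    simp only [hgσ r hr3] at key
    have hsq : √(2 * r ^ 2) ≤ 2 * r := Real.sqrt_le_iff.2 ⟨by positivity, by nlinarith⟩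
    have : 4 * (ε / 9) * √(2 * r ^ 2) ≤ 4 * (ε / 9) * (2 * r) := by gcongr
    nlinarith [mul_pos hε hr0]
  · intro r h hh hK
    have h1 : eg.symm (2 * r ^ 2) ≤ eH.symm h := (eH.le_symm_apply).2 hK
    have h2 := eg.monotone h1
    simp only [hv2 hh.1]
    rwa [OrderIso.apply_symm_apply, heg _ (Ioo_subset_Icc_self (hτT h hh))] at h2
  · intro M hM r hr
    have htT := hσT r hr
    have hsubI : Icc 0 (eg.symm (2 * r ^ 2)) ⊆ Icc 0 T := Icc_subset_Icc le_rfl htT.2.le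
    -- Here `g / s ≤ M g'`, so `H ≤ 2 M g`, evaluated where `g = 2r²`.
    have key := le_of_hasDerivAt_le (A := H) (B := fun t => 2 * M * g t)
      (A' := fun s => 2 * (g s / s)) (B' := fun s => 2 * M * g' s) htT.1
      (Hc.mono hsubI) (continuousOn_const.mul (hc.mono hsubI))
      (fun s hs => Hd s ⟨hs.1, hs.2.trans htT.2⟩)
      (fun s hs => (hd s ⟨hs.1, hs.2.trans htT.2⟩).const_mul _)
      (fun s hs => by
        have hsT : s ∈ Ioo 0 T := ⟨hs.1, hs.2.trans htT.2⟩
        have h1 := hM s hsT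
        rw [div_le_iff₀ (mul_pos hs.1 (hg' s hsT))] at h1
        have : g s / s ≤ M * g' s := by
          rw [div_le_iff₀ hs.1]; linarith
        linarith)
      H0 (by simp [h0])
    simp only [hgσ r hr] at key
    simp only [hKH r hr]
    linarith

/-! ### The operator on radial functions. -/

section Radial

variable {N : ℕ} {w w₁ : ℝ → ℝ}

theorem partialDeriv_comp_norm (hw : ∀ r, 0 < r → HasDerivAt w (w₁ r) r)
    {x : EuclideanSpace ℝ (Fin N)} (hx : x ≠ 0) (i : Fin N) :
    partialDeriv i (fun x => w ‖x‖) x = w₁ ‖x‖ / ‖x‖ * x i := by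
  have h := (hw _ (norm_pos_iff.2 hx)).comp_hasFDerivAt x (hasFDerivAt_norm_of_ne_zero hx)
  have h' : HasFDerivAt (fun x => w ‖x‖) _ x := h
  rw [partialDeriv, h'.fderiv]
  simp [EuclideanSpace.inner_single_right]
  ring

theorem partialDeriv_partialDeriv_comp_norm (hw : ∀ r, 0 < r → HasDerivAt w (w₁ r) r)
    {x : EuclideanSpace ℝ (Fin N)} (hx : x ≠ 0) {d : ℝ} (hw₁ : HasDerivAt w₁ d ‖x‖) (i : Fin N) :
    partialDeriv i (partialDeriv i (fun x => w ‖x‖)) x =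
      (d - w₁ ‖x‖ / ‖x‖) / ‖x‖ ^ 2 * x i ^ 2 + w₁ ‖x‖ / ‖x‖ := by
  have hn := norm_pos_iff.2 hx
  have heq : partialDeriv i (fun x => w ‖x‖) =ᶠ[𝓝 x] fun y => w₁ ‖y‖ / ‖y‖ * y i := by
    filter_upwards [isOpen_ne.mem_nhds hx] with y hy using partialDeriv_comp_norm hw hy i
  have h1 : HasFDerivAt (fun y : EuclideanSpace ℝ (Fin N) => w₁ ‖y‖ / ‖y‖) _ x :=
    (hw₁.div (hasDerivAt_id _) hn.ne').comp_hasFDerivAt x (hasFDerivAt_norm_of_ne_zero hx)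
  have h2 : HasFDerivAt (fun y : EuclideanSpace ℝ (Fin N) => y i)
    (EuclideanSpace.proj i : EuclideanSpace ℝ (Fin N) →L[ℝ] ℝ) x :=
    (EuclideanSpace.proj i : EuclideanSpace ℝ (Fin N) →L[ℝ] ℝ).hasFDerivAt
  have h3 : HasFDerivAt (fun y => w₁ ‖y‖ / ‖y‖ * y i) _ x := h1.mul h2
  rw [partialDeriv, heq.fderiv_eq, h3.fderiv]
  simp [EuclideanSpace.inner_single_right]
  field_simp
  ring

/-- The Hessian of a radial function has eigenvalue `w''` along the ray and `w' / r` across it. -/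
theorem operatorF_comp_norm {n : ℕ} (g : ℝ → ℝ) (hw : ∀ r, 0 < r → HasDerivAt w (w₁ r) r)
    {x : EuclideanSpace ℝ (Fin (n + 1))} (hx : x ≠ 0) {d : ℝ} (hw₁ : HasDerivAt w₁ d ‖x‖) :
    operatorF g (fun x => w ‖x‖) x =
      (d - w₁ ‖x‖ / ‖x‖) / ‖x‖ ^ 2 * (‖x‖ ^ 2 - x (Fin.last n) ^ 2) + n * (w₁ ‖x‖ / ‖x‖) +
        g ((w₁ ‖x‖ / ‖x‖ * x (Fin.last n)) ^ 2) *
          ((d - w₁ ‖x‖ / ‖x‖) / ‖x‖ ^ 2 * x (Fin.last n) ^ 2 + w₁ ‖x‖ / ‖x‖) := by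
  have hsum : ∑ i : Fin n, x i.castSucc ^ 2 = ‖x‖ ^ 2 - x (Fin.last n) ^ 2 := by
    rw [EuclideanSpace.real_norm_sq_eq, Fin.sum_univ_castSucc]; ring
  simp only [operatorF, partialDeriv_partialDeriv_comp_norm hw hx hw₁, partialDeriv_comp_norm hw hx]
  rw [Finset.sum_add_distrib, ← Finset.mul_sum, hsum]
  simp

/-- The differential inequality `v' ≤ v / (4 g(v²))` makes the radial function with slope `-v` a
supersolution where `sin² θ ≤ g(v²)`. -/
theorem operatorF_comp_norm_nonpos {n : ℕ} (hn : 1 ≤ n) {g : ℝ → ℝ}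
    (hw : ∀ r, 0 < r → HasDerivAt w (w₁ r) r)
    {x : EuclideanSpace ℝ (Fin (n + 1))} {v : ℝ} (hv : 0 < v) (hwv : w₁ ‖x‖ = -v)
    (hw₁ : HasDerivAt w₁ (v / (4 * g (v ^ 2))) ‖x‖) (hg : 0 < g (v ^ 2))
    (hg0 : ∀ t, 0 ≤ t → 0 ≤ g t) (hgm : ∀ t ∈ Icc 0 (v ^ 2), g t ≤ g (v ^ 2))
    (hx1 : ‖x‖ ≤ 1) (hx2 : 3 / 4 ≤ ‖x‖)
    (hs : ‖x‖ ^ 2 - x (Fin.last n) ^ 2 ≤ 1 / 4)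
    (hs' : 2 * (‖x‖ ^ 2 - x (Fin.last n) ^ 2) ≤ g (v ^ 2)) :
    operatorF g (fun x => w ‖x‖) x ≤ 0 := by
  have hx0 : x ≠ 0 := norm_pos_iff.1 (by linarith)
  rw [operatorF_comp_norm g hw hx0 hw₁, hwv]
  have hle : x (Fin.last n) ^ 2 ≤ ‖x‖ ^ 2 := by
    have := PiLp.norm_apply_le x (Fin.last n)
    rw [← sq_abs (x _)]; gcongr; simpa using this
  generalize hr : ‖x‖ = r at *
  generalize hy : x (Fin.last n) = y at *
  have hr0 : 0 < r := by linarith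
  have hγ1 : g ((-v / r * y) ^ 2) ≤ g (v ^ 2) := by
    refine hgm _ ⟨sq_nonneg _, ?_⟩
    have : (-v / r * y) ^ 2 = v ^ 2 * (y ^ 2 / r ^ 2) := by ring
    rw [this]
    exact mul_le_of_le_one_right (by positivity) ((div_le_one (by positivity)).2 hle)
  have hγ0 := hg0 _ (sq_nonneg (-v / r * y))
  generalize g ((-v / r * y) ^ 2) = γ at *
  generalize g (v ^ 2) = G at *
  have hn' : (1 : ℝ) ≤ n := by exact_mod_cast hn
  -- `s` is `sin²θ`, with `θ` the angle to the last axis.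
  set s := (r ^ 2 - y ^ 2) / r ^ 2 with hsdef
  have hc : y ^ 2 / r ^ 2 = 1 - s := by rw [hsdef]; field_simp; ring
  have hs0 : 0 ≤ s := div_nonneg (by linarith) (by positivity)
  have hs1 : s ≤ 1 / 2 := by
    rw [hsdef, div_le_iff₀ (by positivity)]; nlinarith
  have hr2 : 1 / 2 ≤ r ^ 2 := by nlinarith
  have hsG : s ≤ G := by
    rw [hsdef, div_le_iff₀ (by positivity)]; nlinarith
  have hexp : (v / (4 * G) - -v / r) / r ^ 2 * (r ^ 2 - y ^ 2) + n * (-v / r) +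
      γ * ((v / (4 * G) - -v / r) / r ^ 2 * y ^ 2 + -v / r) =
      v / (4 * G) * (s + γ * (1 - s)) - v / r * (n - s + γ * s) := by
    rw [← hc, hsdef]; field_simp; ring
  rw [hexp]
  -- Both `s` and `γ` are at most `G`; the `4` in the equation for `v` leaves `v / 2`.
  have h1 : v / (4 * G) * (s + γ * (1 - s)) ≤ v / 2 := by
    have : s + γ * (1 - s) ≤ 2 * G := by nlinarith
    calc v / (4 * G) * (s + γ * (1 - s)) ≤ v / (4 * G) * (2 * G) := by gcongr
      _ = v / 2 := by field_simp; ring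
  have h2 : v / 2 ≤ v / r * (n - s + γ * s) := by
    have h3 : 1 / 2 ≤ n - s + γ * s := by nlinarith [mul_nonneg hγ0 hs0]
    have h4 : v ≤ v / r := by rw [le_div_iff₀ hr0]; nlinarith
    nlinarith
  linarith

end Radial

/-! ### The thinned ball as a regular region. -/

section Domain

variable {N : ℕ} {k k' : ℝ → ℝ}

/-- The ball of centre `c` and radius `a`, thinned in the directions seen by `L`. -/
def thinnedBall (k : ℝ → ℝ) (L : EuclideanSpace ℝ (Fin N) →L[ℝ] EuclideanSpace ℝ (Fin N))
    (c : EuclideanSpace ℝ (Fin N)) (a : ℝ) : Set (EuclideanSpace ℝ (Fin N)) :=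
  {x | ‖x - c‖ ^ 2 + k ‖L x‖ - a ^ 2 < 0}

variable {L : EuclideanSpace ℝ (Fin N) →L[ℝ] EuclideanSpace ℝ (Fin N)}
  {c : EuclideanSpace ℝ (Fin N)} {a : ℝ}

theorem hasFDerivAt_thinnedBall (h0 : k 0 = 0) (hk : ∀ r, 0 < r → HasDerivAt k (k' r) r)
    (hlim0 : Tendsto (fun r => k r / r) (𝓝[>] 0) (𝓝 0)) (x : EuclideanSpace ℝ (Fin N)) :
    HasFDerivAt (fun x => ‖x - c‖ ^ 2 + k ‖L x‖ - a ^ 2)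
      ((2 : ℝ) • innerSL ℝ (x - c) + ((k' ‖L x‖ / ‖L x‖) • innerSL ℝ (L x)).comp L) x := by
  have h1 : HasFDerivAt (fun x => ‖x - c‖ ^ 2) ((2 : ℝ) • innerSL ℝ (x - c)) x := by
    have h := (hasStrictFDerivAt_norm_sq (x - c)).hasFDerivAt.comp x
      ((hasFDerivAt_id x).sub_const c)
    refine h.congr_fderiv ?_
    ext y
    simp
  have h2 := (hasFDerivAt_comp_norm h0 hk hlim0 (L x)).comp x L.hasFDerivAt
  exact (h1.add h2).sub_const _

theorem contDiff_thinnedBall (h0 : k 0 = 0) (hk : ∀ r, 0 < r → HasDerivAt k (k' r) r)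
    (hk'c : ContinuousOn k' (Ioi 0)) (hlim : Tendsto k' (𝓝[>] 0) (𝓝 0))
    (hlim0 : Tendsto (fun r => k r / r) (𝓝[>] 0) (𝓝 0)) :
    ContDiff ℝ 1 (fun x : EuclideanSpace ℝ (Fin N) => ‖x - c‖ ^ 2 + k ‖L x‖ - a ^ 2) := by
  refine contDiff_one_iff_hasFDerivAt.2 ⟨_, ?_, hasFDerivAt_thinnedBall h0 hk hlim0⟩
  have h1 : Continuous fun x : EuclideanSpace ℝ (Fin N) =>
      (k' ‖L x‖ / ‖L x‖) • innerSL ℝ (L x) :=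
    (continuous_smul_innerSL hk'c hlim).comp L.continuous
  have h2 : Continuous fun x : EuclideanSpace ℝ (Fin N) => (2 : ℝ) • innerSL ℝ (x - c) := by
    fun_prop
  exact h2.add (h1.clm_comp continuous_const)

theorem monotoneOn_Ici_of_hasDerivAt (h0 : k 0 = 0) (hk : ∀ r, 0 < r → HasDerivAt k (k' r) r)
    (hk'0 : ∀ r, 0 < r → 0 ≤ k' r) (hlim0 : Tendsto (fun r => k r / r) (𝓝[>] 0) (𝓝 0)) :
    MonotoneOn k (Ici 0) := by
  have hc : ContinuousOn k (Ici 0) := by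
    have : Continuous fun x : ℝ => k ‖x‖ := continuous_iff_continuousAt.2 fun x =>
      (hasFDerivAt_comp_norm h0 hk hlim0 x).continuousAt
    refine this.continuousOn.congr fun x hx => ?_
    simp only [Real.norm_of_nonneg (mem_Ici.1 hx)]
  refine monotoneOn_of_deriv_nonneg (convex_Ici 0) hc ?_ ?_
  · rw [interior_Ici]
    exact fun r hr => (hk r hr).differentiableAt.differentiableWithinAt
  · rw [interior_Ici]
    intro r hr
    rw [(hk r hr).deriv]
    exact hk'0 r hr

theorem thinnedBall_subset_ball (h0 : k 0 = 0) (hm : MonotoneOn k (Ici 0)) (ha : 0 < a) :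
    thinnedBall k L c a ⊆ Metric.ball c a := by
  intro x hx
  have h1 : ‖x - c‖ ^ 2 + k ‖L x‖ - a ^ 2 < 0 := hx
  have h2 : 0 ≤ k ‖L x‖ := h0 ▸ hm (by simp) (norm_nonneg _) (norm_nonneg _)
  rw [mem_ball_iff_norm]
  exact lt_of_pow_lt_pow_left₀ 2 ha.le (by linarith)

/-- Moving towards `c` scales `‖x - c‖` and `‖L x‖` by the same factor, and the defining function
increases with both. This supplies connectedness. -/
theorem starConvex_thinnedBall (hm : MonotoneOn k (Ici 0)) (hLc : L c = 0) :
    StarConvex ℝ c (thinnedBall k L c a) := by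
  rintro y hy b t hb ht hbt
  have ht1 : t ≤ 1 := by linarith
  have h1 : ‖y - c‖ ^ 2 + k ‖L y‖ - a ^ 2 < 0 := hy
  have h2 : b • c + t • y - c = t • (y - c) := by
    rw [show b = 1 - t by linarith]; module
  change ‖b • c + t • y - c‖ ^ 2 + k ‖L (b • c + t • y)‖ - a ^ 2 < 0
  rw [h2, map_add, map_smul, map_smul, hLc, smul_zero, zero_add, norm_smul, norm_smul,
    Real.norm_of_nonneg ht]
  have h3 : t * ‖y - c‖ ≤ ‖y - c‖ := mul_le_of_le_one_left (norm_nonneg _) ht1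
  have h4 : k (t * ‖L y‖) ≤ k ‖L y‖ := hm (mul_nonneg ht (norm_nonneg _)) (norm_nonneg _)
    (mul_le_of_le_one_left (norm_nonneg _) ht1)
  have h5 : (t * ‖y - c‖) ^ 2 ≤ ‖y - c‖ ^ 2 := by gcongr
  linarith

/-- Boundary points of the zero set are regular. -/
theorem isLocalDefiningFunction_thinnedBall (h0 : k 0 = 0)
    (hk : ∀ r, 0 < r → HasDerivAt k (k' r) r) (hk'0 : ∀ r, 0 < r → 0 ≤ k' r)
    (hk'c : ContinuousOn k' (Ioi 0)) (hlim : Tendsto k' (𝓝[>] 0) (𝓝 0))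
    (hlim0 : Tendsto (fun r => k r / r) (𝓝[>] 0) (𝓝 0)) (hLc : L c = 0)
    {x : EuclideanSpace ℝ (Fin N)} (hx : x ≠ c) :
    IsLocalDefiningFunction (thinnedBall k L c a) x
      (fun x => ‖x - c‖ ^ 2 + k ‖L x‖ - a ^ 2) where
  contDiffAt := (contDiff_thinnedBall h0 hk hk'c hlim hlim0).contDiffAt
  gradient_ne_zero := by
    intro h
    rw [gradient, (hasFDerivAt_thinnedBall h0 hk hlim0 x).fderiv,
      EmbeddingLike.map_eq_zero_iff] at h
    -- Tested on `x - c`, the derivative is `2 ‖x - c‖²` plus a nonnegative term.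
    have h1 := DFunLike.congr_fun h (x - c)
    have hn : 0 < ‖x - c‖ := norm_pos_iff.2 (sub_ne_zero.2 hx)
    have hL : L x = L (x - c) := by rw [map_sub, hLc, sub_zero]
    rw [hL] at h1
    generalize x - c = y at *
    simp only [add_apply, smul_apply, innerSL_apply_apply,
      ContinuousLinearMap.comp_apply, real_inner_self_eq_norm_sq,
      smul_eq_mul, zero_apply] at h1
    have h2 : 0 ≤ k' ‖L y‖ / ‖L y‖ * ‖L y‖ ^ 2 := by
      rcases (norm_nonneg (L y)).eq_or_lt with h | h
      · simp [← h]
      · have := hk'0 _ h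
        positivity
    nlinarith [pow_pos hn 2]
  mem_iff := Eventually.of_forall fun _ => Iff.rfl

theorem isRegularRegion_thinnedBall (h0 : k 0 = 0)
    (hk : ∀ r, 0 < r → HasDerivAt k (k' r) r) (hk'0 : ∀ r, 0 < r → 0 ≤ k' r)
    (hk'c : ContinuousOn k' (Ioi 0)) (hlim : Tendsto k' (𝓝[>] 0) (𝓝 0))
    (hlim0 : Tendsto (fun r => k r / r) (𝓝[>] 0) (𝓝 0)) (hLc : L c = 0) (ha : 0 < a) :
    IsRegularRegion (thinnedBall k L c a) := by
  have hm := monotoneOn_Ici_of_hasDerivAt h0 hk hk'0 hlim0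
  have hcont := (contDiff_thinnedBall (c := c) (L := L) (a := a) h0 hk hk'c hlim hlim0).continuous
  have hopen : IsOpen (thinnedBall k L c a) := isOpen_lt hcont continuous_const
  have hc : c ∈ thinnedBall k L c a := by
    simpa [thinnedBall, hLc, h0] using pow_pos ha 2
  refine ⟨hopen, ⟨⟨c, hc⟩, ?_⟩, Metric.isBounded_ball.subset (thinnedBall_subset_ball h0 hm ha), ?_⟩
  · exact ((starConvex_thinnedBall hm hLc).isPathConnected hc).isConnected.isPreconnected
  · intro x hx
    refine ⟨_, isLocalDefiningFunction_thinnedBall h0 hk hk'0 hk'c hlim hlim0 hLc ?_⟩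
    rintro rfl
    rw [hopen.frontier_eq] at hx
    exact hx.2 hc

theorem mem_frontier_thinnedBall (h0 : k 0 = 0) (hLc : L c = 0) (ha : 0 < a)
    {e : EuclideanSpace ℝ (Fin N)} (he : ‖e‖ = 1) (hLe : L e = 0) :
    c + a • e ∈ frontier (thinnedBall k L c a) := by
  -- Thinning is invisible along the axis, where the defining function changes sign at `t = 1`.
  have hval : ∀ t : ℝ, ‖c + (t * a) • e - c‖ ^ 2 + k ‖L (c + (t * a) • e)‖ - a ^ 2 =
      (t ^ 2 - 1) * a ^ 2 := by
    intro t
    simp [hLc, hLe, h0, norm_smul, he, mul_pow]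
    ring
  rw [frontier_eq_closure_inter_closure]
  constructor
  · have h1 : Tendsto (fun t : ℝ => c + (t * a) • e) (𝓝[<] 1) (𝓝 (c + a • e)) := by
      have : Continuous fun t : ℝ => c + (t * a) • e := by fun_prop
      exact (this.tendsto' 1 _ (by simp)).mono_left nhdsWithin_le_nhds
    refine mem_closure_of_tendsto h1 ?_
    filter_upwards [Ioo_mem_nhdsLT (zero_lt_one (α := ℝ))] with t ht
    rw [thinnedBall, mem_ofPred_eq, hval]
    have : t ^ 2 < 1 := by nlinarith [ht.1, ht.2]
    have := pow_pos ha 2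
    nlinarith
  · refine subset_closure ?_
    have := hval 1
    rw [one_mul] at this
    rw [mem_compl_iff, thinnedBall, mem_ofPred_eq, this]
    simp

theorem isOuterUnitNormal_thinnedBall (h0 : k 0 = 0)
    (hk : ∀ r, 0 < r → HasDerivAt k (k' r) r) (hk'0 : ∀ r, 0 < r → 0 ≤ k' r)
    (hk'c : ContinuousOn k' (Ioi 0)) (hlim : Tendsto k' (𝓝[>] 0) (𝓝 0))
    (hlim0 : Tendsto (fun r => k r / r) (𝓝[>] 0) (𝓝 0)) (hLc : L c = 0) (ha : 0 < a)
    {e : EuclideanSpace ℝ (Fin N)} (he : ‖e‖ = 1) (hLe : L e = 0) :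
    IsOuterUnitNormal (thinnedBall k L c a) (c + a • e) e := by
  refine ⟨he, _, isLocalDefiningFunction_thinnedBall h0 hk hk'0 hk'c hlim hlim0 hLc ?_, ?_⟩
  · have : e ≠ 0 := norm_pos_iff.1 (by rw [he]; exact one_pos)
    simp [ha.ne', this]
  · have hg : gradient (fun x => ‖x - c‖ ^ 2 + k ‖L x‖ - a ^ 2) (c + a • e) = (2 * a) • e := by
      refine ext_inner_right ℝ fun y => ?_
      rw [gradient, (hasFDerivAt_thinnedBall h0 hk hlim0 _).fderiv,
        InnerProductSpace.toDual_symm_apply]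
      simp [hLc, hLe, inner_smul_left]
      ring
    rw [hg, norm_smul, he, mul_one, Real.norm_of_nonneg (by positivity)]

end Domain

/-! ### Choice of the thinning and geometry near the pole. -/

theorem ContDiffOn.succ_of_hasDerivAt {f f' : ℝ → ℝ} {s : Set ℝ} (hs : IsOpen s) {m : ℕ}
    (hd : ∀ x ∈ s, HasDerivAt f (f' x) x) (hc : ContDiffOn ℝ m f' s) :
    ContDiffOn ℝ (m + 1) f s := by
  rw [contDiffOn_succ_iff_deriv_of_isOpen hs]
  refine ⟨fun x hx => (hd x hx).differentiableAt.differentiableWithinAt, by simp, ?_⟩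
  exact hc.congr fun x hx => (hd x hx).deriv

/-- The thinning of the ball: none if `K` is quadratically small, a `C¹` majorant of `K` if not. -/
theorem exists_thinning {K : ℝ → ℝ} {δ ρ : ℝ} (hδ : 0 < δ) (hρ : 0 < ρ) (hc : Continuous K)
    (hm : MonotoneOn K (Ici 0)) (h0 : K 0 = 0)
    (hlim : Tendsto (fun r => K r / r) (𝓝[>] 0) (𝓝 0)) {P : Prop}
    (hP : P → ∃ M, ∀ r ∈ Ico 0 ρ, K r ≤ M * r ^ 2) :
    ∃ (a : ℝ) (k k' : ℝ → ℝ), 0 < a ∧ a ≤ 1 / 8 ∧ 2 * a ≤ δ ∧ k 0 = 0 ∧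
      (∀ r, 0 < r → HasDerivAt k (k' r) r) ∧ (∀ r, 0 < r → 0 ≤ k' r) ∧
      ContinuousOn k' (Ioi 0) ∧ Tendsto k' (𝓝[>] 0) (𝓝 0) ∧
      Tendsto (fun r => k r / r) (𝓝[>] 0) (𝓝 0) ∧
      (∀ r ∈ Ico 0 a, K r ≤ (r ^ 2 + k r) / (4 * a)) ∧ (P → k = 0) := by
  by_cases hPP : P
  · obtain ⟨M, hM⟩ := hP hPP
    -- Chosen so that `M r² ≤ r² / (4a)` whenever `a ≤ b`.
    set b := 1 / (4 * (|M| + 1)) with hb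
    have hb0 : 0 < b := by positivity
    have hMb : M * (4 * b) ≤ 1 := by
      have : M * (4 * b) = M / (|M| + 1) := by rw [hb]; field_simp
      rw [this, div_le_one (by positivity)]
      linarith [le_abs_self M]
    refine ⟨min (min (1 / 8) (δ / 2)) (min ρ b), 0, 0, by positivity, ?_, ?_, rfl, ?_, by simp, ?_,
      ?_, ?_, ?_, fun _ => rfl⟩
    · exact (min_le_left _ _).trans (min_le_left _ _)
    · linarith [(min_le_left (min (1 / 8) (δ / 2)) (min ρ b)).trans (min_le_right _ _)]
    · exact fun r _ => hasDerivAt_const r 0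
    · exact continuousOn_const
    · exact tendsto_const_nhds
    · simp
    · intro r hr
      have h1 : r < ρ := hr.2.trans_le ((min_le_right _ _).trans (min_le_left _ _))
      have ha : min (min (1 / 8) (δ / 2)) (min ρ b) ≤ b := (min_le_right _ _).trans (min_le_right _ _)
      have ha0 : 0 < min (min (1 / 8) (δ / 2)) (min ρ b) := by positivity
      refine (hM r ⟨hr.1, h1⟩).trans ?_
      rw [le_div_iff₀ (by positivity)]
      generalize min (min (1 / 8) (δ / 2)) (min ρ b) = a at *
      have h2 : M * (4 * a) ≤ 1 := by
        rcases le_total M 0 with h | h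
        · nlinarith
        · exact (by gcongr : M * (4 * a) ≤ M * (4 * b)).trans hMb
      simp only [Pi.zero_apply, add_zero]
      nlinarith [sq_nonneg r]
  · obtain ⟨k, k', hk0, hk, hk', hk'c, hk'lim, hklim, hKk⟩ := exists_C1_majorant hc hm h0 hlim
    refine ⟨min (1 / 8) (δ / 2), k, k', by positivity, min_le_left _ _, ?_, hk0, hk, hk', hk'c,
      hk'lim, hklim, ?_, fun h => absurd h hPP⟩
    · linarith [min_le_right (1 / 8) (δ / 2)]
    · intro r hr
      have h1 := hKk r hr.1
      have h2 : 0 ≤ K r := h0 ▸ hm (by simp) hr.1 hr.1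
      -- Since `4a ≤ 1` and `K ≥ 0`, the majorant alone suffices.
      have ha : min (1 / 8) (δ / 2) ≤ 1 / 8 := min_le_left _ _
      have ha0 : 0 < min (1 / 8) (δ / 2) := by positivity
      rw [le_div_iff₀ (by positivity)]
      nlinarith [sq_nonneg r]

/-- The projection along the last coordinate axis. -/
noncomputable def dropLast (n : ℕ) :
    EuclideanSpace ℝ (Fin (n + 1)) →L[ℝ] EuclideanSpace ℝ (Fin (n + 1)) :=
  ContinuousLinearMap.id ℝ _ -
    (EuclideanSpace.proj (Fin.last n)).smulRight (EuclideanSpace.single (Fin.last n) (1 : ℝ))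

theorem dropLast_apply {n : ℕ} (x : EuclideanSpace ℝ (Fin (n + 1))) :
    dropLast n x = x - x (Fin.last n) • EuclideanSpace.single (Fin.last n) (1 : ℝ) := rfl

theorem norm_sub_smul_single_sq {n : ℕ} (x : EuclideanSpace ℝ (Fin (n + 1))) (b : ℝ) :
    ‖x - b • EuclideanSpace.single (Fin.last n) (1 : ℝ)‖ ^ 2 =
      ‖x‖ ^ 2 - 2 * b * x (Fin.last n) + b ^ 2 := by
  rw [norm_sub_sq_real, inner_smul_right, norm_smul, EuclideanSpace.inner_single_right]
  simp
  ring

theorem norm_dropLast_sq {n : ℕ} (x : EuclideanSpace ℝ (Fin (n + 1))) :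
    ‖dropLast n x‖ ^ 2 = ‖x‖ ^ 2 - x (Fin.last n) ^ 2 := by
  rw [dropLast_apply, norm_sub_smul_single_sq]
  ring

theorem dropLast_single {n : ℕ} :
    dropLast n (EuclideanSpace.single (Fin.last n) (1 : ℝ)) = 0 := by
  simp [dropLast_apply]

/-- Position of the points of the thinned ball touching the unit sphere at the north pole. -/
theorem bounds_of_mem_thinnedBall {n : ℕ} {k : ℝ → ℝ} {a : ℝ} (ha : 0 < a) (ha8 : a ≤ 1 / 8)
    (hk : ∀ r, 0 ≤ r → 0 ≤ k r) {x : EuclideanSpace ℝ (Fin (n + 1))}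
    (hx : x ∈ thinnedBall k (dropLast n) ((1 - a) • EuclideanSpace.single (Fin.last n) (1 : ℝ)) a) :
    1 - 2 * a < ‖x‖ ∧ ‖x‖ < 1 ∧ ‖dropLast n x‖ < a ∧
      (‖dropLast n x‖ ^ 2 + k ‖dropLast n x‖) / (4 * a) ≤ 1 - ‖x‖ := by
  have h1 : ‖x - (1 - a) • EuclideanSpace.single (Fin.last n) (1 : ℝ)‖ ^ 2 +
    k ‖dropLast n x‖ - a ^ 2 < 0 := hx
  rw [norm_sub_smul_single_sq] at h1
  have h2 := norm_dropLast_sq x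
  have h3 := hk _ (norm_nonneg (dropLast n x))
  have hr := norm_nonneg x
  have hρ := norm_nonneg (dropLast n x)
  generalize k ‖dropLast n x‖ = κ at *
  generalize ‖dropLast n x‖ = ρ at *
  generalize ‖x‖ = r at *
  generalize x (Fin.last n) = y at *
  have h4 : ρ ^ 2 + (1 - y) ^ 2 + κ < 2 * a * (1 - y) := by nlinarith
  have hy : 0 < 1 - y := by
    have : 0 < 2 * a * (1 - y) := by nlinarith [sq_nonneg ρ, sq_nonneg (1 - y)]
    exact pos_of_mul_pos_right this (by linarith)
  have hy2 : 1 - y < 2 * a := by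
    have : (1 - y) * (1 - y) < 2 * a * (1 - y) := by nlinarith [sq_nonneg ρ]
    exact lt_of_mul_lt_mul_right this hy.le
  have hr1 : r < 1 := by nlinarith
  -- Replaces height by depth at the cost of a factor two: `ρ² + κ < 2a (1 - y) ≤ 4a (1 - r)`.
  have hr2 : (1 - y) / 2 ≤ 1 - r := by nlinarith
  refine ⟨by nlinarith [sq_nonneg ρ], hr1, ?_, ?_⟩
  · exact lt_of_pow_lt_pow_left₀ 2 ha.le (by nlinarith [sq_nonneg (1 - y - a)])
  · rw [div_le_iff₀ (by positivity)]
    nlinarith [sq_nonneg (1 - y)]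

/-! ### Assembly of the counterexample. -/

/-- A function with positive derivative for which `g(t)^{3/2} / (t g'(t)) → 0` while `t g'(t)`
stays bounded vanishes at the origin. -/
theorem eq_zero_of_tendsto_rpow_div {g g' : ℝ → ℝ} {T : ℝ} (hT : 0 < T)
    (hm : MonotoneOn g (Icc 0 T)) (h0 : 0 ≤ g 0) (hg' : ∀ t ∈ Ioo 0 T, 0 < g' t)
    (hg1 : ∀ t ∈ Ioo 0 T, t * g' t ≤ 1)
    (hlim : Tendsto (fun t => g t ^ (3 / 2 : ℝ) / (t * g' t)) (𝓝[>] 0) (𝓝 0)) : g 0 = 0 := by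
  by_contra hne
  have hpos : 0 < g 0 := lt_of_le_of_ne h0 (Ne.symm hne)
  have hle : g 0 ^ (3 / 2 : ℝ) ≤ 0 := by
    refine ge_of_tendsto hlim ?_
    filter_upwards [Ioo_mem_nhdsGT hT] with t ht
    have h1 := hm (left_mem_Icc.2 hT.le) (Ioo_subset_Icc_self ht) ht.1.le
    rw [le_div_iff₀ (mul_pos ht.1 (hg' t ht))]
    have h2 : g 0 ^ (3 / 2 : ℝ) ≤ g t ^ (3 / 2 : ℝ) := by gcongr
    have h3 := hg1 t ht
    have h4 : 0 < g 0 ^ (3 / 2 : ℝ) := by positivity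
    nlinarith
  have : 0 < g 0 ^ (3 / 2 : ℝ) := by positivity
  linarith

theorem theorem4p1 (n : ℕ) (hn : 1 ≤ n) (g : ℝ → ℝ) (T : ℝ)
    (hg_cont : ContinuousOn g (Set.Ici 0)) (hg_nonneg : ∀ t, 0 ≤ t → 0 ≤ g t)
    (hL : AssumptionL g T) (hG : AssumptionG g)
    (hg' : ∀ t ∈ Set.Ioc 0 T, 0 < derivWithin g (Set.Ioc 0 T) t)
    (hg1 : ∀ t ∈ Set.Ioc 0 T, g t + derivWithin g (Set.Ioc 0 T) t * t ≤ 1)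
    (hlim : Filter.Tendsto
      (fun t => g t ^ (3 / 2 : ℝ) / (t * derivWithin g (Set.Ioc 0 T) t))
      (nhdsWithin 0 (Set.Ioi 0)) (nhds 0)) :
    ∃ (Ω : Set (EuclideanSpace ℝ (Fin (n + 1)))) (u : EuclideanSpace ℝ (Fin (n + 1)) → ℝ)
      (z ν : EuclideanSpace ℝ (Fin (n + 1))),
      IsRegularRegion Ω ∧
      (∃ w : ℝ → ℝ, ∀ x ∈ closure Ω, u x = w ‖x‖) ∧
      ContDiffOn ℝ 2 u Ω ∧
      ContinuousOn u (closure Ω) ∧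
      (∀ x ∈ Ω, operatorF g u x ≤ 0) ∧
      z ∈ frontier Ω ∧
      u z = 0 ∧
      (∀ x ∈ Ω, u z < u x) ∧
      IsOuterUnitNormal Ω z ν ∧
      HasDerivWithinAt (fun s : ℝ => u (z + s • ν)) 0 (Set.Iic 0) 0 ∧
      ((∃ M, ∀ t ∈ Set.Ioc 0 T, |g t / (t * derivWithin g (Set.Ioc 0 T) t)| ≤ M) →
        InteriorBallCondition Ω z) := by
  set g' := derivWithin g (Set.Ioc 0 T) with hg'def
  have hd : ∀ t ∈ Ioo 0 T, HasDerivAt g (g' t) t := fun t ht =>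
    (hL.differentiableOn t ⟨ht.1, ht.2.le⟩).hasDerivWithinAt.hasDerivAt
      (Ioc_mem_nhds ht.1 ht.2)
  have hgm := strictMonoOn_Icc_of_hasDerivAt_pos hL.continuousOn hd
    fun t ht => hg' t ⟨ht.1, ht.2.le⟩
  have hg00 : g 0 = 0 := eq_zero_of_tendsto_rpow_div hL.pos_T hgm.monotoneOn (hg_nonneg 0 le_rfl)
    (fun t ht => hg' t ⟨ht.1, ht.2.le⟩)
    (fun t ht => by
      have h1 := hg1 t ⟨ht.1, ht.2.le⟩
      have h2 := hL.pos t ⟨ht.1, ht.2.le⟩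
      linarith) hlim
  obtain ⟨T₀, hT₀, hT₀T, hle⟩ : ∃ T₀, 0 < T₀ ∧ T₀ ≤ T ∧
      ∀ t ∈ Ioo 0 T₀, g t ^ (3 / 2 : ℝ) / (t * g' t) ≤ 1 := by
    have h1 := hlim (Iic_mem_nhds (zero_lt_one (α := ℝ)))
    rw [mem_map, mem_nhdsGT_iff_exists_Ioo_subset' hL.pos_T] at h1
    obtain ⟨t₁, ht₁, hsub⟩ := h1
    exact ⟨min t₁ T, lt_min ht₁ hL.pos_T, min_le_right _ _,
      fun t ht => hsub ⟨ht.1, ht.2.trans_le (min_le_left _ _)⟩⟩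
  have hsubT : ∀ {t}, t ∈ Ioo 0 T₀ → t ∈ Ioc 0 T := fun ht => ⟨ht.1, ht.2.le.trans hT₀T⟩
  obtain ⟨v, K, δ, ρ, hδ, hρ, hvc, hv0, hvpos, hvd, hKc, hKm, hK0, hKlim, hKg, hKM⟩ :=
    exists_profile hT₀ (hL.continuousOn.mono (Icc_subset_Icc le_rfl hT₀T)) hg00
      (fun t ht => hL.pos t ⟨ht.1, ht.2.trans hT₀T⟩)
      (fun t ht => hd t ⟨ht.1, ht.2.trans_le hT₀T⟩) (fun t ht => hg' t (hsubT ht)) hle hlim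
  obtain ⟨a, k, k', ha, ha8, haδ, hk0, hk, hk'0, hk'c, hk'lim, hklim, hKk, hball⟩ :=
    exists_thinning (P := ∃ M, ∀ t ∈ Ioc 0 T, |g t / (t * g' t)| ≤ M) hδ hρ hKc hKm hK0 hKlim
      (fun ⟨M, hM⟩ => ⟨4 * M, hKM M fun t ht => (le_abs_self _).trans (hM t (hsubT ht))⟩)
  set e : EuclideanSpace ℝ (Fin (n + 1)) := EuclideanSpace.single (Fin.last n) 1 with he
  have hne : ‖e‖ = 1 := by simp [he]
  have hLe : dropLast n e = 0 := dropLast_single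
  set c : EuclideanSpace ℝ (Fin (n + 1)) := (1 - a) • e with hcdef
  have hLc : dropLast n c = 0 := by rw [hcdef, map_smul, hLe, smul_zero]
  have hz : c + a • e = e := by rw [hcdef]; module
  have hkm := monotoneOn_Ici_of_hasDerivAt hk0 hk hk'0 hklim
  have hknn : ∀ r, 0 ≤ r → 0 ≤ k r := fun r hr => hk0 ▸ hkm self_mem_Ici hr hr
  have hbd : ∀ {x}, x ∈ thinnedBall k (dropLast n) c a → _ := fun hx =>
    bounds_of_mem_thinnedBall ha ha8 hknn hx
  set W : ℝ → ℝ := fun h => ∫ s in (0 : ℝ)..h, v s with hW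
  have hWd : ∀ h, HasDerivAt W (v h) h := fun h => (hvc.integral_hasStrictDerivAt 0 h).hasDerivAt
  have hWc : Continuous W := continuous_iff_continuousAt.2 fun h => (hWd h).continuousAt
  have hWpos : ∀ h, 0 < h → 0 < W h := fun h hh =>
    intervalIntegral.intervalIntegral_pos_of_pos_on (hvc.intervalIntegrable _ _)
      (fun s hs => hvpos s hs.1) hh
  have hsub1 : ∀ r : ℝ, HasDerivAt (fun r => 1 - r) (-1) r := fun r => by
    simpa using (hasDerivAt_id r).const_sub 1
  have hwd : ∀ r, HasDerivAt (fun r => W (1 - r)) (-v (1 - r)) r := fun r =>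
    ((hWd (1 - r)).comp r (hsub1 r)).congr_deriv (by ring)
  have hwdd : ∀ r ∈ Ioo (1 - δ) 1, HasDerivAt (fun r => -v (1 - r))
      (v (1 - r) / (4 * g (v (1 - r) ^ 2))) r := fun r hr => by
    have h1 := (hvd (1 - r) ⟨by linarith [hr.2], by linarith [hr.1]⟩).2
    exact (h1.comp r (hsub1 r)).neg.congr_deriv (by ring)
  -- The second derivative is continuous because `g(v²)` stays positive at depths in `(0, δ)`.
  have hwC2 : ContDiffOn ℝ 2 (fun r => W (1 - r)) (Ioo (1 - δ) 1) := by
    refine ContDiffOn.succ_of_hasDerivAt (m := 1) isOpen_Ioo (fun r _ => hwd r)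
      (ContDiffOn.succ_of_hasDerivAt (m := 0) isOpen_Ioo hwdd ?_)
    refine contDiffOn_zero.2 (ContinuousOn.div (by fun_prop) ?_ fun r hr => ?_)
    · refine continuousOn_const.mul (hg_cont.comp (by fun_prop) fun r _ => ?_)
      exact mem_Ici.2 (sq_nonneg _)
    · have h1 := (hvd (1 - r) ⟨by linarith [hr.2], by linarith [hr.1]⟩).1
      have := hL.pos _ (hsubT h1)
      positivity
  refine ⟨thinnedBall k (dropLast n) c a, fun x => W (1 - ‖x‖), e, e,
    isRegularRegion_thinnedBall hk0 hk hk'0 hk'c hk'lim hklim hLc ha,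
    ⟨fun r => W (1 - r), fun x _ => rfl⟩, ?_, by fun_prop, ?_,
    hz ▸ mem_frontier_thinnedBall hk0 hLc ha hne hLe, ?_, ?_,
    by simpa only [hz] using
      isOuterUnitNormal_thinnedBall hk0 hk hk'0 hk'c hk'lim hklim hLc ha hne hLe, ?_, ?_⟩
  · intro x hx
    obtain ⟨h1, h2, -, -⟩ := hbd hx
    have hx0 : x ≠ 0 := norm_pos_iff.1 (by linarith)
    have hmem : ‖x‖ ∈ Ioo (1 - δ) 1 := ⟨by linarith, h2⟩
    exact ((hwC2.contDiffAt (Ioo_mem_nhds hmem.1 hmem.2)).comp x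
      (contDiffAt_norm ℝ hx0)).contDiffWithinAt
  · intro x hx
    obtain ⟨h1, h2, h3, h4⟩ := hbd hx
    have hmem : ‖x‖ ∈ Ioo (1 - δ) 1 := ⟨by linarith, h2⟩
    have hmem' : 1 - ‖x‖ ∈ Ioo 0 δ := ⟨by linarith, by linarith⟩
    have hvT := (hvd _ hmem').1
    refine operatorF_comp_norm_nonpos hn (w := fun r => W (1 - r)) (w₁ := fun r => -v (1 - r))
      (fun r _ => hwd r) (hvpos _ hmem'.1) rfl (hwdd _ hmem) (hL.pos _ (hsubT hvT)) hg_nonneg ?_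
      h2.le (by linarith) ?_ ?_
    · exact fun t ht => hgm.monotoneOn ⟨ht.1, ht.2.trans (hsubT hvT).2⟩
        (Ioc_subset_Icc_self (hsubT hvT)) ht.2
    · rw [← norm_dropLast_sq]
      nlinarith [norm_nonneg (dropLast n x)]
    · rw [← norm_dropLast_sq]
      exact hKg _ _ hmem' ((hKk _ ⟨norm_nonneg _, h3⟩).trans h4)
  · simp [hne, hW]
  · intro x hx
    simp only [hne, sub_self]
    rw [show W 0 = 0 by simp [hW]]
    exact hWpos _ (by linarith [(hbd hx).2.1])
  -- At the pole the normal is radial, so the normal derivative is `-v(0) = 0`.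
  · have h1 : HasDerivAt (fun s : ℝ => W (1 - (1 + s))) 0 0 :=
      ((hwd (1 + 0)).comp (0 : ℝ) ((hasDerivAt_id (0 : ℝ)).const_add 1)).congr_deriv
        (by simp [hv0])
    refine HasDerivAt.hasDerivWithinAt (h1.congr_of_eventuallyEq ?_)
    filter_upwards [lt_mem_nhds (show (-1 : ℝ) < 0 by norm_num)] with s hs
    have : e + s • e = (1 + s) • e := by module
    simp only [this, norm_smul, hne, mul_one]
    rw [Real.norm_of_nonneg (by linarith)]
  · intro hM
    have hk00 := hball hM
    refine ⟨c, a, ha, fun x hx => ?_, ?_⟩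
    · rw [mem_ball_iff_norm] at hx
      change ‖x - c‖ ^ 2 + k ‖dropLast n x‖ - a ^ 2 < 0
      rw [hk00, Pi.zero_apply]
      have : ‖x - c‖ ^ 2 < a ^ 2 := by gcongr
      linarith
    · rw [frontier_ball _ ha.ne', mem_sphere_iff_norm, ← hz]
      simp [norm_smul, hne, ha.le]
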